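/- Let $M$ be a von Neumann algebra with unit $\mathbf 1$ and let $\tau$ be a faithful normal semifinite trace on $M$. Let $L_1(M_{sa},\tau)$ be the real Banach space obtained by completing $\{x\in M: x=x^*,\ \tau(|x|)<\infty\}$ in the norm $\|x\|_1=\tau(|x|)$; its positive cone is the closure of the set of those $x$ in this space that are positive elements of $M$, and its dual is $M_{sa}=\{y\in M: y=y^*\}$ via $\langle x,y\rangle=\tau(xy)$. A linear operator $T$ on $L_1(M_{sa},\tau)$ is called positive if $Tx\ge 0$ whenever $x\ge 0$, and a contraction if $\|Tx\|_1\le\|x\|_1$ for all $x$; a positive contraction $T$ is called unital if its conjugate $T^*:M_{sa}\to M_{sa}$ satisfies $T^*\mathbf 1=\mathbf 1$ (equivalently, $\tau(Tx)=\tau(x)$ for all $x$). We write $S\le T$ if $T-S$ is positive, and $\|\cdot\|$ denotes the operator norm. Let $T_1,\dots,T_d$ be unital positive contractions of $L_1(M_{sa},\tau)$ with $T_iT_j=T_jT_i$ for all $i,j$, and put $\mathbf T^{\mathbf n}=T_1^{n_1}\cdots T_d^{n_d}$ for $\mathbf n=(n_1,\dots,n_d)\in\mathbb N_0^d$. Suppose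 that there are $\mathbf m,\mathbf k\in\mathbb N_0^d$ and a positive contraction $S$ of $L_1(M_{sa},\tau)$ such that $$\mathbf T^{\mathbf m+\mathbf k}\ge S,\qquad \mathbf T^{\mathbf m}\ge S,\qquad \|\mathbf T^{\mathbf m+\mathbf k}-S\|<1,\qquad \|\mathbf T^{\mathbf m}-S\|<1 .$$ Then $$\lim_{\mathbf n\to\infty}\|\mathbf T^{\mathbf n+\mathbf k}-\mathbf T^{\mathbf n}\|=0,$$ that is, for every $\varepsilon>0$ there is $\mathbf n_0\in\mathbb N_0^d$ such that $\|\mathbf T^{\mathbf n+\mathbf k}-\mathbf T^{\mathbf n}\|<\varepsilon$ for all $\mathbf n\ge\mathbf n_0$ (coordinatewise). -/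

import Mathlib

open scoped NNReal ENNReal

noncomputable section

namespace NCL1

/-! ### A von Neumann algebra as an ordered C⋆-algebra

The type `↥M` of elements of a von Neumann algebra `M ⊆ B(H)` is a C⋆-algebra for the operator
norm; its order is the order of operators (`x ≤ y` iff `y - x` is a positive operator). -/

section VN

variable {H : Type*} [NormedAddCommGroup H] [InnerProductSpace ℂ H] [CompleteSpace H]

instance instSMulMemClass : SMulMemClass (VonNeumannAlgebra H) ℂ (H →L[ℂ] H) where
  smul_mem {S} r _ hx := S.toStarSubalgebra.smul_mem hx r

instance instIsClosed (M : VonNeumannAlgebra H) : IsClosed (M : Set (H →L[ℂ] H)) := by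
  rw [← M.centralizer_centralizer]
  exact Set.isClosed_centralizer _

instance instCStarAlgebra (M : VonNeumannAlgebra H) : CStarAlgebra M :=
  StarSubalgebra.cstarAlgebra M

theorem sqrt_mem (M : VonNeumannAlgebra H) {x : H →L[ℂ] H} (hx : x ∈ M) :
    CFC.sqrt x ∈ M := by
  rw [← SetLike.mem_coe, ← M.centralizer_centralizer]
  intro c hc
  have h1 : Commute x c := hc x hx
  exact (h1.cfcₙ_nnreal NNReal.sqrt).symm

instance instStarOrderedRing (M : VonNeumannAlgebra H) : StarOrderedRing M := by
  refine StarOrderedRing.of_nonneg_iff' (fun {x y} h z => ?_) (fun x => ⟨fun h => ?_, ?_⟩)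
  · exact add_le_add_right (α := H →L[ℂ] H) h z
  · have h' : (0 : H →L[ℂ] H) ≤ x := h
    refine ⟨⟨CFC.sqrt (x : H →L[ℂ] H), sqrt_mem M x.2⟩, Subtype.ext ?_⟩
    have h2 : star (CFC.sqrt (x : H →L[ℂ] H)) = CFC.sqrt (x : H →L[ℂ] H) :=
      (CFC.sqrt_nonneg (x : H →L[ℂ] H)).isSelfAdjoint
    change (x : H →L[ℂ] H) = star (CFC.sqrt (x : H →L[ℂ] H)) * CFC.sqrt (x : H →L[ℂ] H)
    rw [h2, CFC.sqrt_mul_sqrt_self (x : H →L[ℂ] H) h']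
  · rintro ⟨s, rfl⟩
    exact star_mul_self_nonneg (s : H →L[ℂ] H)

end VN

/-! ### Faithful normal semifinite traces -/

variable {A : Type*} [CStarAlgebra A] [PartialOrder A] [StarOrderedRing A]

/-- A faithful normal semifinite trace `τ : A₊ → [0, ∞]`. It is carried by a function on `A`,
but only its values on the positive cone are ever constrained or used. -/
structure FNSTrace (A : Type*) [CStarAlgebra A] [PartialOrder A] [StarOrderedRing A] where
  toFun : A → ℝ≥0∞
  map_add : ∀ x y : A, 0 ≤ x → 0 ≤ y → toFun (x + y) = toFun x + toFun y
  map_smul : ∀ (r : ℝ≥0) (x : A), 0 ≤ x → toFun (r • x) = r * toFun x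
  map_star_mul_self : ∀ x : A, toFun (star x * x) = toFun (x * star x)
  faithful : ∀ x : A, 0 ≤ x → toFun x = 0 → x = 0
  /-- normality: suprema of bounded increasing families of positive elements are preserved -/
  normal : ∀ (D : Set A) (s : A), D.Nonempty → DirectedOn (· ≤ ·) D → (∀ x ∈ D, 0 ≤ x) →
    IsLUB D s → toFun s = ⨆ x ∈ D, toFun x
  semifinite : ∀ x : A, 0 ≤ x → x ≠ 0 → ∃ y : A, 0 ≤ y ∧ y ≤ x ∧ y ≠ 0 ∧ toFun y < ∞

namespace FNSTrace

instance : CoeFun (FNSTrace A) (fun _ => A → ℝ≥0∞) := ⟨FNSTrace.toFun⟩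

variable (τ : FNSTrace A)

theorem map_zero : τ 0 = 0 := by
  simpa using τ.map_smul 0 0 le_rfl

theorem mono {x y : A} (hx : 0 ≤ x) (hxy : x ≤ y) : τ x ≤ τ y := by
  have h := τ.map_add x (y - x) hx (sub_nonneg.2 hxy)
  rw [add_sub_cancel] at h
  rw [h]
  exact le_self_add

theorem map_smul_real {r : ℝ} (hr : 0 ≤ r) {x : A} (hx : 0 ≤ x) :
    τ (r • x) = ENNReal.ofReal r * τ x := by
  lift r to ℝ≥0 using hr
  simpa using! τ.map_smul r x hx

theorem conj_le {a g : A} (ha : 0 ≤ a) (hg : IsSelfAdjoint g) (hg1 : g * g ≤ 1) :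
    τ (g * a * g) ≤ τ a := by
  have hs : star (CFC.sqrt a) = CFC.sqrt a := (CFC.sqrt_nonneg a).isSelfAdjoint
  have hss : CFC.sqrt a * CFC.sqrt a = a := CFC.sqrt_mul_sqrt_self a ha
  have h := τ.map_star_mul_self (CFC.sqrt a * g)
  rw [star_mul, hs, hg.star_eq] at h
  have e1 : g * CFC.sqrt a * (CFC.sqrt a * g) = g * a * g := by
    rw [mul_assoc, ← mul_assoc (CFC.sqrt a), hss, mul_assoc]
  have e2 : CFC.sqrt a * g * (g * CFC.sqrt a) = CFC.sqrt a * (g * g) * CFC.sqrt a := by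
    simp only [mul_assoc]
  rw [e1, e2] at h
  rw [h]
  refine τ.mono ?_ ?_
  · refine conjugate_nonneg_of_nonneg ?_ (CFC.sqrt_nonneg a)
    simpa [hg.star_eq] using star_mul_self_nonneg g
  · simpa [hss] using conjugate_le_conjugate_of_nonneg hg1 (CFC.sqrt_nonneg a)

/-- If `x = a - b` with `a, b ≥ 0` then `τ(x⁺) ≤ τ(a)`. -/
theorem posPart_le {a b : A} (ha : 0 ≤ a) (hb : 0 ≤ b) : τ ((a - b)⁺) ≤ τ a := by
  set x := a - b with hx
  have hxsa : IsSelfAdjoint x := ha.isSelfAdjoint.sub hb.isSelfAdjoint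
  let g : ℕ → ℝ → ℝ := fun n t => √(n * max t 0 / (1 + n * max t 0))
  let h : ℕ → ℝ → ℝ := fun n t => max t 0 * (n * max t 0 / (1 + n * max t 0))
  have hpos : ∀ (n : ℕ) (t : ℝ), 0 < 1 + n * max t 0 := fun n t => by positivity
  have hgc : ∀ n, Continuous (g n) := fun n =>
    Real.continuous_sqrt.comp ((by fun_prop : Continuous fun t : ℝ => (n : ℝ) * max t 0).div
      (by fun_prop) fun t => (hpos n t).ne')
  have hhc : ∀ n, Continuous (h n) := fun n =>
    (by fun_prop : Continuous fun t : ℝ => max t 0).mul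
      ((by fun_prop : Continuous fun t : ℝ => (n : ℝ) * max t 0).div
      (by fun_prop) fun t => (hpos n t).ne')
  have hgg : ∀ n t, g n t * g n t = n * max t 0 / (1 + n * max t 0) := fun n t =>
    Real.mul_self_sqrt (by positivity)
  have hpp : x⁺ = cfc (fun t : ℝ => max t 0) x := by
    rw [CFC.posPart_def, cfcₙ_eq_cfc]; rfl
  have hgxg : ∀ n, cfc (g n) x * x * cfc (g n) x = cfc (h n) x := fun n => by
    conv_lhs => enter [1, 2]; rw [← cfc_id ℝ x]
    rw [← cfc_mul _ _ x (hgc n).continuousOn continuousOn_id,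
      ← cfc_mul (fun t => g n t * id t) (g n) x ((hgc n).mul continuous_id).continuousOn
        (hgc n).continuousOn]
    congr 1
    funext t
    have e : g n t * t * g n t = t * (g n t * g n t) := by ring
    simp only [id]
    rw [e, hgg]
    rcases le_total t 0 with ht | ht
    · simp [h, max_eq_right ht]
    · simp [h, max_eq_left ht]
  have hh0 : ∀ n, 0 ≤ cfc (h n) x := fun n => cfc_nonneg fun t _ => by positivity
  have hhle : ∀ n, τ (cfc (h n) x) ≤ τ a := fun n => by
    have hgsa : IsSelfAdjoint (cfc (g n) x) := cfc_predicate _ _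
    refine le_trans (τ.mono (hh0 n) ?_) (τ.conj_le ha hgsa ?_)
    · rw [← hgxg n, hx, mul_sub, sub_mul]
      exact sub_le_self _ (hgsa.conjugate_nonneg hb)
    · rw [← cfc_mul _ _ x (hgc n).continuousOn (hgc n).continuousOn]
      refine cfc_le_one _ _ fun t _ => ?_
      rw [hgg, div_le_one (hpos n t)]
      linarith
  have hmono : Monotone fun n => cfc (h n) x := fun m n hmn => by
    refine cfc_mono (fun t _ => ?_) (hhc m).continuousOn (hhc n).continuousOn
    refine mul_le_mul_of_nonneg_left ?_ (le_max_right _ _)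
    rw [div_le_div_iff₀ (hpos m t) (hpos n t)]
    have : (m : ℝ) ≤ n := by exact_mod_cast hmn
    nlinarith [mul_le_mul_of_nonneg_right this (le_max_right t 0)]
  have hlub : IsLUB (Set.range fun n => cfc (h n) x) (x⁺) := by
    refine ⟨?_, fun c hc => ?_⟩
    · rintro _ ⟨n, rfl⟩
      rw [hpp]
      refine cfc_mono (fun t _ => ?_) (hhc n).continuousOn (by fun_prop)
      refine mul_le_of_le_one_right (le_max_right _ _) ?_
      rw [div_le_one (hpos n t)]
      linarith
    · have hn : ∀ n : ℕ, 0 ≤ c - x⁺ + algebraMap ℝ A (1 / ((n : ℝ) + 1)) := fun n => by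
        have h1 : cfc (h (n + 1)) x ≤ c := hc ⟨n + 1, rfl⟩
        have h2 : x⁺ ≤ cfc (h (n + 1)) x + algebraMap ℝ A (1 / ((n : ℝ) + 1)) := by
          rw [hpp, ← cfc_const (1 / ((n : ℝ) + 1)) x, ← cfc_add _ _ _ (hhc _).continuousOn
            continuousOn_const]
          refine cfc_mono (fun t _ => ?_) (by fun_prop)
            ((hhc _).add continuous_const).continuousOn
          have h3 := hpos (n + 1) t
          push_cast at h3
          have hn1 : (0 : ℝ) < n + 1 := by positivity
          have h0 : (0 : ℝ) ≤ max t 0 := le_max_right _ _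
          simp only [h]
          push_cast
          generalize max t 0 = u at *
          rw [← sub_nonneg]
          have : u * ((n + 1) * u / (1 + (n + 1) * u)) + 1 / ((n : ℝ) + 1) - u
              = 1 / ((n + 1) * (1 + (n + 1) * u)) := by
            field_simp
            ring
          rw [this]
          positivity
        have h4 := h2.trans (add_le_add_left h1 _)
        rw [sub_add_eq_add_sub]
        exact sub_nonneg.2 h4
      have ht : Filter.Tendsto (fun n : ℕ => c - x⁺ + algebraMap ℝ A (1 / ((n : ℝ) + 1)))
          Filter.atTop (nhds (c - x⁺ + algebraMap ℝ A 0)) :=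
        tendsto_const_nhds.add (((algebraMapCLM ℝ A).continuous.tendsto 0).comp
          tendsto_one_div_add_atTop_nhds_zero_nat)
      have := (CStarAlgebra.isClosed_nonneg (A := A)).mem_of_tendsto ht
        (Filter.Eventually.of_forall hn)
      rw [_root_.map_zero, add_zero] at this
      exact sub_nonneg.1 this
  rw [τ.normal _ _ (Set.range_nonempty _) (hmono.directed_le.directedOn_range) ?_ hlub]
  · refine iSup₂_le ?_
    rintro _ ⟨n, rfl⟩
    exact hhle n
  · rintro _ ⟨n, rfl⟩
    exact hh0 n

theorem abs_eq {x : A} (hx : IsSelfAdjoint x) : τ (CFC.abs x) = τ (x⁺) + τ (x⁻) := by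
  rw [← CFC.posPart_add_negPart x hx, τ.map_add _ _ (CFC.posPart_nonneg x) (CFC.negPart_nonneg x)]

theorem abs_sub_le {a b : A} (ha : 0 ≤ a) (hb : 0 ≤ b) : τ (CFC.abs (a - b)) ≤ τ a + τ b := by
  rw [τ.abs_eq (ha.isSelfAdjoint.sub hb.isSelfAdjoint)]
  refine add_le_add (τ.posPart_le ha hb) ?_
  rw [← CFC.posPart_neg, neg_sub]
  exact τ.posPart_le hb ha

theorem abs_add_le {x y : A} (hx : IsSelfAdjoint x) (hy : IsSelfAdjoint y) :
    τ (CFC.abs (x + y)) ≤ τ (CFC.abs x) + τ (CFC.abs y) := by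
  have e : x + y = (x⁺ + y⁺) - (x⁻ + y⁻) := by
    conv_lhs => rw [← CFC.posPart_sub_negPart x hx, ← CFC.posPart_sub_negPart y hy]
    abel
  have px := CFC.posPart_nonneg x
  have py := CFC.posPart_nonneg y
  have nx := CFC.negPart_nonneg x
  have ny := CFC.negPart_nonneg y
  rw [e]
  refine (τ.abs_sub_le (add_nonneg px py) (add_nonneg nx ny)).trans ?_
  rw [τ.abs_eq hx, τ.abs_eq hy, τ.map_add _ _ px py, τ.map_add _ _ nx ny]
  exact (add_add_add_comm _ _ _ _).le

theorem abs_smul (r : ℝ) {x : A} :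
    τ (CFC.abs (r • x)) = ENNReal.ofReal |r| * τ (CFC.abs x) := by
  rw [CFC.abs_smul, Real.norm_eq_abs, τ.map_smul_real (abs_nonneg r) (CFC.abs_nonneg x)]

/-! ### The space `L₁(M_sa, τ)` -/

/-- The real vector space `𝔑_sa` of self-adjoint `x` with `τ(|x|) < ∞`. -/
def nsaSubmodule : Submodule ℝ A where
  carrier := {x | IsSelfAdjoint x ∧ τ (CFC.abs x) < ∞}
  zero_mem' := ⟨IsSelfAdjoint.zero A, by simp [τ.map_zero]⟩
  add_mem' := fun hx hy =>
    ⟨hx.1.add hy.1, (τ.abs_add_le hx.1 hy.1).trans_lt (ENNReal.add_lt_top.2 ⟨hx.2, hy.2⟩)⟩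
  smul_mem' := fun r x hx =>
    ⟨(IsSelfAdjoint.all r).smul hx.1, by
      rw [τ.abs_smul]; exact ENNReal.mul_lt_top ENNReal.ofReal_lt_top hx.2⟩

/-- `𝔑_sa` as a type of its own, so that it carries the trace norm and not the operator norm. -/
def Nsa : Type _ := τ.nsaSubmodule

instance : AddCommGroup τ.Nsa := inferInstanceAs (AddCommGroup τ.nsaSubmodule)

instance : Module ℝ τ.Nsa := inferInstanceAs (Module ℝ τ.nsaSubmodule)

/-- The inclusion `𝔑_sa → A`. -/
def Nsa.val : τ.Nsa →ₗ[ℝ] A := τ.nsaSubmodule.subtype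

/-- The trace norm `‖x‖₁ = τ(|x|)`. -/
instance : Norm τ.Nsa := ⟨fun x => (τ (CFC.abs (Nsa.val τ x))).toReal⟩

theorem Nsa.norm_def (x : τ.Nsa) : ‖x‖ = (τ (CFC.abs (Nsa.val τ x))).toReal := rfl

theorem Nsa.isSelfAdjoint (x : τ.Nsa) : IsSelfAdjoint (Nsa.val τ x) := x.2.1

theorem Nsa.abs_lt_top (x : τ.Nsa) : τ (CFC.abs (Nsa.val τ x)) < ∞ := x.2.2

theorem Nsa.core : NormedSpace.Core ℝ τ.Nsa where
  norm_nonneg _ := ENNReal.toReal_nonneg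
  norm_smul r x := by
    rw [Nsa.norm_def, Nsa.norm_def, _root_.map_smul, τ.abs_smul, ENNReal.toReal_mul,
      ENNReal.toReal_ofReal (abs_nonneg r), Real.norm_eq_abs]
  norm_triangle x y := by
    rw [Nsa.norm_def, Nsa.norm_def, Nsa.norm_def, _root_.map_add,
      ← ENNReal.toReal_add (Nsa.abs_lt_top τ x).ne (Nsa.abs_lt_top τ y).ne]
    exact ENNReal.toReal_mono
      (ENNReal.add_lt_top.2 ⟨Nsa.abs_lt_top τ x, Nsa.abs_lt_top τ y⟩).ne
      (τ.abs_add_le (Nsa.isSelfAdjoint τ x) (Nsa.isSelfAdjoint τ y))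
  norm_eq_zero_iff x := by
    rw [Nsa.norm_def]
    constructor
    · intro h
      have h1 : τ (CFC.abs (Nsa.val τ x)) = 0 :=
        (ENNReal.toReal_eq_zero_iff _).1 h |>.resolve_right (Nsa.abs_lt_top τ x).ne
      exact Subtype.ext (CFC.abs_eq_zero_iff.1 (τ.faithful _ (CFC.abs_nonneg _) h1))
    · rintro rfl
      simp [τ.map_zero]

instance : NormedAddCommGroup τ.Nsa := NormedAddCommGroup.ofCore (Nsa.core τ)

instance : NormedSpace ℝ τ.Nsa := NormedSpace.ofCore (Nsa.core τ)

/-- The real Banach space `L₁(A_sa, τ)`: the completion of `𝔑_sa` in the norm `‖x‖₁ = τ(|x|)`. -/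
abbrev L1 : Type _ := UniformSpace.Completion τ.Nsa

/-- The positive cone of `L₁(A_sa, τ)`: the closure of the positive elements of `𝔑_sa`. -/
def posCone : Set τ.L1 :=
  closure ((fun x : τ.Nsa => (x : τ.L1)) '' {x | 0 ≤ Nsa.val τ x})

theorem posPart_lt_top (x : τ.Nsa) : τ ((Nsa.val τ x)⁺) < ∞ :=
  lt_of_le_of_lt (by rw [τ.abs_eq (Nsa.isSelfAdjoint τ x)]; exact le_self_add)
    (Nsa.abs_lt_top τ x)

theorem negPart_lt_top (x : τ.Nsa) : τ ((Nsa.val τ x)⁻) < ∞ :=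
  lt_of_le_of_lt (by rw [τ.abs_eq (Nsa.isSelfAdjoint τ x)]; exact le_add_self)
    (Nsa.abs_lt_top τ x)

theorem toReal_sub_eq {a b c d : A} (ha : 0 ≤ a) (hb : 0 ≤ b) (hc : 0 ≤ c) (hd : 0 ≤ d)
    (fa : τ a < ∞) (fb : τ b < ∞) (fc : τ c < ∞) (fd : τ d < ∞) (h : a - b = c - d) :
    (τ a).toReal - (τ b).toReal = (τ c).toReal - (τ d).toReal := by
  have h1 : a + d = c + b := by rw [sub_eq_sub_iff_add_eq_add] at h; exact h
  have h2 := congrArg (fun z => (τ z).toReal) h1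
  simp only [τ.map_add _ _ ha hd, τ.map_add _ _ hc hb, ENNReal.toReal_add fa.ne fd.ne,
    ENNReal.toReal_add fc.ne fb.ne] at h2
  linarith

/-- The trace as a linear functional on `𝔑_sa`: `x ↦ τ(x⁺) - τ(x⁻)`. -/
def trNsa : τ.Nsa →ₗ[ℝ] ℝ where
  toFun x := (τ ((Nsa.val τ x)⁺)).toReal - (τ ((Nsa.val τ x)⁻)).toReal
  map_add' x y := by
    have e : (Nsa.val τ (x + y))⁺ - (Nsa.val τ (x + y))⁻
        = ((Nsa.val τ x)⁺ + (Nsa.val τ y)⁺) - ((Nsa.val τ x)⁻ + (Nsa.val τ y)⁻) := by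
      rw [CFC.posPart_sub_negPart _ (Nsa.isSelfAdjoint τ _), _root_.map_add]
      conv_lhs => rw [← CFC.posPart_sub_negPart _ (Nsa.isSelfAdjoint τ x),
        ← CFC.posPart_sub_negPart _ (Nsa.isSelfAdjoint τ y)]
      abel
    have px := CFC.posPart_nonneg (Nsa.val τ x)
    have py := CFC.posPart_nonneg (Nsa.val τ y)
    have nx := CFC.negPart_nonneg (Nsa.val τ x)
    have ny := CFC.negPart_nonneg (Nsa.val τ y)
    have fpx := τ.posPart_lt_top x
    have fpy := τ.posPart_lt_top y
    have fnx := τ.negPart_lt_top x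
    have fny := τ.negPart_lt_top y
    rw [τ.toReal_sub_eq (CFC.posPart_nonneg _) (CFC.negPart_nonneg _) (add_nonneg px py)
      (add_nonneg nx ny) (τ.posPart_lt_top _) (τ.negPart_lt_top _)
      (by rw [τ.map_add _ _ px py]; exact ENNReal.add_lt_top.2 ⟨fpx, fpy⟩)
      (by rw [τ.map_add _ _ nx ny]; exact ENNReal.add_lt_top.2 ⟨fnx, fny⟩) e,
      τ.map_add _ _ px py, τ.map_add _ _ nx ny, ENNReal.toReal_add fpx.ne fpy.ne,
      ENNReal.toReal_add fnx.ne fny.ne]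
    ring
  map_smul' r x := by
    have px := CFC.posPart_nonneg (Nsa.val τ x)
    have nx := CFC.negPart_nonneg (Nsa.val τ x)
    rw [_root_.map_smul]
    rcases le_total 0 r with hr | hr
    · rw [CFC.posPart_smul_of_nonneg hr, CFC.negPart_smul_of_nonneg hr, τ.map_smul_real hr px,
        τ.map_smul_real hr nx, ENNReal.toReal_mul, ENNReal.toReal_mul, ENNReal.toReal_ofReal hr]
      simp only [RingHom.id_apply, smul_eq_mul]
      ring
    · have hr' : 0 ≤ -r := by linarith
      rw [CFC.posPart_smul_of_nonpos hr, CFC.negPart_smul_of_nonpos hr, τ.map_smul_real hr' px,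
        τ.map_smul_real hr' nx, ENNReal.toReal_mul, ENNReal.toReal_mul,
        ENNReal.toReal_ofReal hr']
      simp only [RingHom.id_apply, smul_eq_mul]
      ring

theorem trNsa_bound (x : τ.Nsa) : ‖τ.trNsa x‖ ≤ 1 * ‖x‖ := by
  rw [Nsa.norm_def, τ.abs_eq (Nsa.isSelfAdjoint τ x),
    ENNReal.toReal_add (τ.posPart_lt_top x).ne (τ.negPart_lt_top x).ne, Real.norm_eq_abs, one_mul]
  change |(τ ((Nsa.val τ x)⁺)).toReal - (τ ((Nsa.val τ x)⁻)).toReal| ≤ _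
  have h1 : 0 ≤ (τ ((Nsa.val τ x)⁺)).toReal := ENNReal.toReal_nonneg
  have h2 : 0 ≤ (τ ((Nsa.val τ x)⁻)).toReal := ENNReal.toReal_nonneg
  rw [abs_le]
  constructor <;> linarith

/-- The extension of the trace to a bounded functional on `L₁(A_sa, τ)`. In the duality
`⟨x, y⟩ = τ(xy)` between `L₁(A_sa, τ)` and `A_sa`, it is the functional given by `y = 1`. -/
def trL1 : StrongDual ℝ τ.L1 :=
  (τ.trNsa.mkContinuous 1 τ.trNsa_bound).extend
    (UniformSpace.Completion.toComplL : τ.Nsa →L[ℝ] τ.L1)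

theorem trL1_coe (x : τ.Nsa) :
    τ.trL1 (x : τ.L1) = (τ ((Nsa.val τ x)⁺)).toReal - (τ ((Nsa.val τ x)⁻)).toReal :=
  ContinuousLinearMap.extend_eq _ UniformSpace.Completion.denseRange_coe
    (UniformSpace.Completion.isUniformInducing_coe _) x

/-! ### Operators on `L₁(M_sa, τ)` -/

variable {τ}

/-- `T` is positive: `T x ≥ 0` whenever `x ≥ 0`. -/
def IsPositiveOp (T : τ.L1 →L[ℝ] τ.L1) : Prop := ∀ x ∈ τ.posCone, T x ∈ τ.posCone

/-- `S ≤ T`: the operator `T - S` is positive. -/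
def OpLE (S T : τ.L1 →L[ℝ] τ.L1) : Prop := IsPositiveOp (T - S)

/-- Positive contraction. -/
def IsPositiveContraction (T : τ.L1 →L[ℝ] τ.L1) : Prop :=
  IsPositiveOp T ∧ ∀ x, ‖T x‖ ≤ ‖x‖

/-- Unital positive contraction: `T⋆ 1 = 1`, where the conjugate `T⋆ φ = φ ∘ T` acts on the dual
`A_sa` of `L₁(A_sa, τ)` and `1 ∈ A_sa` is the functional `trL1`. -/
def IsUnitalPositiveContraction (T : τ.L1 →L[ℝ] τ.L1) : Prop :=
  IsPositiveContraction T ∧ τ.trL1.comp T = τ.trL1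

/-- `T^n = T₁^{n₁} ⋯ T_d^{n_d}`, the product being composition of operators. -/
def multiPow {d : ℕ} (T : Fin d → (τ.L1 →L[ℝ] τ.L1)) (n : Fin d → ℕ) : τ.L1 →L[ℝ] τ.L1 :=
  (List.ofFn fun i => T i ^ n i).prod

end FNSTrace

end NCL1

end

open scoped NNReal ENNReal

noncomputable section

namespace NCL1

/-! ### Powers of an averaged power-bounded element -/

section Averages

variable {E : Type*} [NormedRing E]

/-! Put `U = T^m`, `P = T^k`, `W = U P = T^(m+k)` and `B = (1 + P) / 2`. From `U ≥ S` follows `W = P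
U ≥ P S`; together with `W ≥ S` this gives `W ≥ B S`, so `W = B S + R` with `R` positive. On the
positive cone the norm is the trace, which `W` and `B` preserve, hence `‖R‖ ≤ ‖W - S‖ < 1`.

Iterating the splitting gives `W ^ n = B D + R ^ n` with `D` a contraction
(`exists_pow_eq_mul_add_pow`): up to a geometrically small error a factor `B` splits off. Raising
this to the power `j` splits off `B ^ j`, with error at most `j ‖R ^ n‖`
(`exists_pow_eq_pow_mul_add`). Since neighbouring binomial coefficients almost cancel, `‖(1 - P) B ^
j‖ = O(j ^ (-1/2))` (`norm_one_sub_mul_average_pow_le`). A large `j`, then a large `n`, make `(1 -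
P) W ^ (n j)` small (`exists_norm_one_sub_mul_pow_lt`). Every multi-index above `n j (m + k)` only
contributes a further contraction. -/

theorem sum_choose_mul_sub_sq (n : ℕ) :
    ∑ i ∈ Finset.range (n + 1), (n.choose i : ℝ) * ((n : ℝ) - 2 * i) ^ 2 = (n : ℝ) * 2 ^ n := by
  -- The variance of the binomial law with parameter `1/2` is `n / 4`; the claim is this identity
  -- multiplied by `4 * 2 ^ n`.
  have h := congrArg (Polynomial.eval (1 / 2 : ℝ)) (bernsteinPolynomial.variance ℝ n)
  simp only [Polynomial.eval_finsetSum, Polynomial.eval_mul, Polynomial.eval_pow,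
    Polynomial.eval_sub, Polynomial.eval_X, Polynomial.eval_natCast,
    bernsteinPolynomial, Polynomial.eval_one, nsmul_eq_mul] at h
  have e : ∑ i ∈ Finset.range (n + 1), (n.choose i : ℝ) * ((n : ℝ) - 2 * i) ^ 2
      = 4 * 2 ^ n * ∑ i ∈ Finset.range (n + 1), ((n : ℝ) * (1 / 2) - i) ^ 2 *
        (n.choose i * (1 / 2) ^ i * (1 - 1 / 2) ^ (n - i)) := by
    rw [Finset.mul_sum]
    refine Finset.sum_congr rfl fun i hi => ?_
    have hi' : i ≤ n := Nat.lt_succ_iff.1 (Finset.mem_range.1 hi)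
    have h2 : (1 / 2 : ℝ) ^ i * (1 / 2) ^ (n - i) * 2 ^ n = 1 := by
      rw [← pow_add, Nat.add_sub_cancel' hi', ← mul_pow]; norm_num
    have h3 : (1 - 1 / 2 : ℝ) = 1 / 2 := by norm_num
    rw [h3]
    linear_combination (-(n.choose i : ℝ) * ((n : ℝ) - 2 * i) ^ 2) * h2
  rw [e, h]
  ring

/-- Cauchy–Schwarz with weights `n.choose i`: the mean absolute deviation is at most the standard
deviation. -/
theorem sum_choose_mul_abs_sub_le (n : ℕ) :
    ∑ i ∈ Finset.range (n + 1), (n.choose i : ℝ) * |(n : ℝ) - 2 * i| ≤ 2 ^ n * √n := by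
  have hcs := Finset.sum_mul_sq_le_sq_mul_sq (Finset.range (n + 1))
    (fun i => √(n.choose i : ℝ)) (fun i => √(n.choose i : ℝ) * |(n : ℝ) - 2 * i|)
  have hs : ∀ i, √(n.choose i : ℝ) * √(n.choose i : ℝ) = n.choose i := fun i =>
    Real.mul_self_sqrt (Nat.cast_nonneg _)
  simp only [← mul_assoc, hs, mul_pow, sq_abs, Real.sq_sqrt (Nat.cast_nonneg _),
    sum_choose_mul_sub_sq] at hcs
  have h2 : ∑ i ∈ Finset.range (n + 1), (n.choose i : ℝ) = 2 ^ n := by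
    exact_mod_cast Nat.sum_range_choose n
  rw [h2] at hcs
  refine abs_le_of_sq_le_sq' ?_ (by positivity) |>.2
  rw [mul_pow, Real.sq_sqrt (Nat.cast_nonneg _)]
  linarith

/-- With `f(a) = (1 + a) ^ (n + 1)`, the left side is `(n + 1) f(a) - 2 a f'(a)`. The weights `n + 1
- 2 i` turn the norm of the right side into the mean absolute deviation bounded above. -/
theorem sum_choose_smul_pow [NormedAlgebra ℝ E] (a : E) (n : ℕ) :
    ∑ i ∈ Finset.range (n + 2), (((n + 1).choose i : ℝ) * (((n + 1 : ℕ) : ℝ) - 2 * i)) • a ^ i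
      = ((n : ℝ) + 1) • ((1 - a) * (1 + a) ^ n) := by
  have hb : ∀ n : ℕ, ∑ i ∈ Finset.range (n + 1), (n.choose i : ℝ) • a ^ i = (1 + a) ^ n := by
    intro n
    rw [add_comm 1 a, (Commute.one_right a).add_pow]
    refine Finset.sum_congr rfl fun i _ => ?_
    rw [one_pow, mul_one, Nat.cast_smul_eq_nsmul, nsmul_eq_mul, Nat.cast_comm]
  have hd : ∑ i ∈ Finset.range (n + 2), (((n + 1).choose i : ℝ) * i) • a ^ i
      = ((n : ℝ) + 1) • (a * (1 + a) ^ n) := by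
    rw [Finset.sum_range_succ', ← hb n, Finset.mul_sum, Finset.smul_sum]
    simp only [Nat.cast_zero, mul_zero, zero_smul, add_zero]
    refine Finset.sum_congr rfl fun i _ => ?_
    have h : ((n : ℝ) + 1) * n.choose i = (n + 1).choose (i + 1) * ((i : ℝ) + 1) := by
      exact_mod_cast Nat.add_one_mul_choose_eq n i
    rw [mul_smul_comm, smul_smul, h, pow_succ']
    push_cast
    rfl
  have e : ∀ i : ℕ, (((n + 1).choose i : ℝ) * (((n + 1 : ℕ) : ℝ) - 2 * i)) • a ^ i
      = ((n : ℝ) + 1) • (((n + 1).choose i : ℝ) • a ^ i)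
        - (2 : ℝ) • ((((n + 1).choose i : ℝ) * i) • a ^ i) := by
    intro i
    rw [smul_smul, smul_smul, ← sub_smul]
    congr 1
    push_cast
    ring
  simp only [e]
  rw [Finset.sum_sub_distrib, ← Finset.smul_sum, ← Finset.smul_sum, hb, hd, smul_comm (2 : ℝ),
    ← smul_sub, pow_succ', two_smul]
  congr 1
  noncomm_ring

/-- For `a` with contractive powers, `‖(1 - a) ((1 + a) / 2) ^ n‖ = O(n ^ (-1/2))`. -/
theorem norm_one_sub_mul_average_pow_le [NormedAlgebra ℝ E] {a : E} (ha : ∀ i : ℕ, ‖a ^ i‖ ≤ 1) (n : ℕ) :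
    ‖(1 - a) * ((1 / 2 : ℝ) • (1 + a)) ^ n‖ ≤ 2 / √((n : ℝ) + 1) := by
  have h1 : ‖((n : ℝ) + 1) • ((1 - a) * (1 + a) ^ n)‖ ≤ 2 ^ (n + 1) * √((n : ℝ) + 1) := by
    rw [← sum_choose_smul_pow]
    have h := sum_choose_mul_abs_sub_le (n + 1)
    push_cast at h ⊢
    refine (norm_sum_le_of_le _ fun i _ => ?_).trans h
    rw [norm_smul, norm_mul, Real.norm_eq_abs, Real.norm_eq_abs, Nat.abs_cast]
    exact mul_le_of_le_one_right (by positivity) (ha i)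
  have hn : (0 : ℝ) < (n : ℝ) + 1 := by positivity
  rw [norm_smul, Real.norm_of_nonneg hn.le] at h1
  rw [smul_pow, mul_smul_comm, norm_smul, Real.norm_of_nonneg (by positivity),
    le_div_iff₀ (by positivity)]
  have hs := Real.mul_self_sqrt hn.le
  have hs0 : 0 < √((n : ℝ) + 1) := by positivity
  have hp : (1 / 2 : ℝ) ^ n * 2 ^ n = 1 := by rw [← mul_pow]; norm_num
  generalize ‖(1 - a) * (1 + a) ^ n‖ = c at *
  generalize √((n : ℝ) + 1) = s at *
  rw [← hs] at h1
  have h2 : s * c ≤ 2 ^ (n + 1) := by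
    refine le_of_mul_le_mul_right ?_ hs0
    linarith
  calc (1 / 2 : ℝ) ^ n * c * s = (1 / 2) ^ n * (s * c) := by ring
    _ ≤ (1 / 2) ^ n * 2 ^ (n + 1) := by gcongr
    _ = 2 := by rw [pow_succ, ← mul_assoc, hp, one_mul]

/-- If `v = b e + r` with contractions `v, b, e` and `v b = b v`, then `v ^ j` is `b ^ j` times a
contraction up to an error of norm at most `j ‖r‖`. -/
theorem exists_pow_eq_pow_mul_add {v b e r : E} (h1 : ‖(1 : E)‖ ≤ 1) (hv : ‖v‖ ≤ 1)
    (hb : ∀ i : ℕ, ‖b ^ i‖ ≤ 1) (he : ‖e‖ ≤ 1) (hvb : Commute v b) (h : v = b * e + r) (j : ℕ) :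
    ∃ e' r' : E, v ^ j = b ^ j * e' + r' ∧ ‖e'‖ ≤ 1 ∧ ‖r'‖ ≤ j * ‖r‖ := by
  induction j with
  | zero => exact ⟨1, 0, by simp, h1, by simp⟩
  | succ j ih =>
    obtain ⟨e', r', hj, he', hr'⟩ := ih
    -- As `v` commutes with `b ^ j`, `v ^ (j + 1) = b ^ j * v * e' + v * r'`; expanding this `v` as
    -- `b * e + r` adds one more error of norm at most `‖r‖`.
    refine ⟨e * e', b ^ j * r * e' + v * r', ?_, ?_, ?_⟩
    · rw [pow_succ', hj, mul_add, ← mul_assoc v, (hvb.pow_right j).eq, mul_assoc (b ^ j)]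
      nth_rw 1 [h]
      noncomm_ring
    · exact (norm_mul_le _ _).trans (mul_le_one₀ he (norm_nonneg _) he')
    · have k1 : ‖b ^ j * r * e'‖ ≤ ‖r‖ := by
        calc ‖b ^ j * r * e'‖ ≤ ‖b ^ j‖ * ‖r‖ * ‖e'‖ := norm_mul₃_le
          _ ≤ 1 * ‖r‖ * 1 := by gcongr; exact hb j
          _ = ‖r‖ := by ring
      have k2 : ‖v * r'‖ ≤ j * ‖r‖ :=
        (norm_mul_le _ _).trans ((mul_le_of_le_one_left (norm_nonneg _) hv).trans hr')
      push_cast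
      linarith [norm_add_le (b ^ j * r * e') (v * r')]

end Averages

namespace FNSTrace

variable {A : Type*} [CStarAlgebra A] [PartialOrder A] [StarOrderedRing A] {τ : FNSTrace A}

/-! ### The positive cone of `L₁` -/

theorem coe_mem_posCone {x : τ.Nsa} (hx : 0 ≤ Nsa.val τ x) : (x : τ.L1) ∈ τ.posCone :=
  subset_closure ⟨x, hx, rfl⟩

theorem add_mem_posCone {x y : τ.L1} (hx : x ∈ τ.posCone) (hy : y ∈ τ.posCone) :
    x + y ∈ τ.posCone := by
  refine map_mem_closure₂ continuous_add hx hy ?_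
  rintro _ ⟨a, ha, rfl⟩ _ ⟨b, hb, rfl⟩
  refine ⟨a + b, ?_, UniformSpace.Completion.coe_add a b⟩
  change 0 ≤ Nsa.val τ (a + b)
  rw [_root_.map_add]
  exact add_nonneg ha hb

theorem smul_mem_posCone {r : ℝ} (hr : 0 ≤ r) {x : τ.L1} (hx : x ∈ τ.posCone) :
    r • x ∈ τ.posCone := by
  refine map_mem_closure (continuous_const_smul r) hx ?_
  rintro _ ⟨a, ha, rfl⟩
  refine ⟨r • a, ?_, UniformSpace.Completion.coe_smul r a⟩
  change 0 ≤ Nsa.val τ (r • a)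
  rw [_root_.map_smul]
  exact smul_nonneg hr ha

theorem zero_mem_posCone : (0 : τ.L1) ∈ τ.posCone :=
  coe_mem_posCone (x := 0) (by simp)

/-- The norm of `L₁` is additive on the positive cone, where it is given by the trace. -/
theorem norm_eq_trL1 {x : τ.L1} (hx : x ∈ τ.posCone) : ‖x‖ = τ.trL1 x := by
  refine closure_minimal ?_ (isClosed_eq continuous_norm τ.trL1.continuous) hx
  rintro _ ⟨a, ha, rfl⟩
  have ha' : 0 ≤ Nsa.val τ a := ha
  change ‖(a : τ.L1)‖ = τ.trL1 a
  rw [UniformSpace.Completion.norm_coe, trL1_coe, Nsa.norm_def, CFC.abs_of_nonneg _ ha',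
    (CFC.posPart_eq_self _).2 ha', (CFC.negPart_eq_zero_iff _).2 ha', τ.map_zero]
  simp

theorem exists_sub_eq (x : τ.Nsa) : ∃ a b : τ.Nsa, 0 ≤ Nsa.val τ a ∧ 0 ≤ Nsa.val τ b ∧
    x = a - b ∧ ‖x‖ = ‖a‖ + ‖b‖ := by
  have px := CFC.posPart_nonneg (Nsa.val τ x)
  have nx := CFC.negPart_nonneg (Nsa.val τ x)
  have ep := CFC.abs_of_nonneg _ px
  have en := CFC.abs_of_nonneg _ nx
  refine ⟨⟨(Nsa.val τ x)⁺, px.isSelfAdjoint, by rw [ep]; exact τ.posPart_lt_top x⟩,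
    ⟨(Nsa.val τ x)⁻, nx.isSelfAdjoint, by rw [en]; exact τ.negPart_lt_top x⟩, px, nx,
    Subtype.ext (CFC.posPart_sub_negPart _ (Nsa.isSelfAdjoint τ x)).symm, ?_⟩
  change _ = (τ (CFC.abs (Nsa.val τ x)⁺)).toReal + (τ (CFC.abs (Nsa.val τ x)⁻)).toReal
  rw [ep, en, Nsa.norm_def, τ.abs_eq (Nsa.isSelfAdjoint τ x),
    ENNReal.toReal_add (τ.posPart_lt_top x).ne (τ.negPart_lt_top x).ne]

/-! ### Positive operators -/

/-- The Jordan decomposition `x = x⁺ - x⁻` is additive for the trace norm, so a bound on the cone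
extends to the dense subspace, and then to `L₁`, with the same constant. -/
theorem opNorm_le_of_posCone {R : τ.L1 →L[ℝ] τ.L1} {c : ℝ} (hc : 0 ≤ c)
    (h : ∀ x ∈ τ.posCone, ‖R x‖ ≤ c * ‖x‖) : ‖R‖ ≤ c := by
  refine R.opNorm_le_bound hc fun x => ?_
  induction x using UniformSpace.Completion.induction_on with
  | hp => exact isClosed_le (by fun_prop) (by fun_prop)
  | ih x =>
    obtain ⟨a, b, ha, hb, rfl, hab⟩ := exists_sub_eq x
    rw [UniformSpace.Completion.norm_coe, hab, UniformSpace.Completion.coe_sub, map_sub, mul_add]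
    refine (norm_sub_le _ _).trans (add_le_add ?_ ?_)
    · simpa using h _ (coe_mem_posCone ha)
    · simpa using h _ (coe_mem_posCone hb)

/-- For positive operators, norm estimates thereby become trace computations. -/
theorem IsPositiveOp.opNorm_le {R : τ.L1 →L[ℝ] τ.L1} (hR : IsPositiveOp R) {c : ℝ} (hc : 0 ≤ c)
    (h : ∀ x ∈ τ.posCone, τ.trL1 (R x) ≤ c * τ.trL1 x) : ‖R‖ ≤ c :=
  opNorm_le_of_posCone hc fun x hx => by
    rw [norm_eq_trL1 (hR x hx), norm_eq_trL1 hx]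
    exact h x hx

theorem IsPositiveOp.add {P Q : τ.L1 →L[ℝ] τ.L1} (hP : IsPositiveOp P) (hQ : IsPositiveOp Q) :
    IsPositiveOp (P + Q) := fun x hx => add_mem_posCone (hP x hx) (hQ x hx)

theorem IsPositiveOp.smul {P : τ.L1 →L[ℝ] τ.L1} (hP : IsPositiveOp P) {r : ℝ} (hr : 0 ≤ r) :
    IsPositiveOp (r • P) := fun x hx => smul_mem_posCone hr (hP x hx)

theorem IsPositiveOp.mul {P Q : τ.L1 →L[ℝ] τ.L1} (hP : IsPositiveOp P) (hQ : IsPositiveOp Q) :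
    IsPositiveOp (P * Q) := fun x hx => hP _ (hQ x hx)

theorem isPositiveOp_one : IsPositiveOp (1 : τ.L1 →L[ℝ] τ.L1) := fun _ hx => hx

theorem isPositiveOp_zero : IsPositiveOp (0 : τ.L1 →L[ℝ] τ.L1) := fun _ _ => zero_mem_posCone

theorem IsPositiveOp.pow {P : τ.L1 →L[ℝ] τ.L1} (hP : IsPositiveOp P) (n : ℕ) :
    IsPositiveOp (P ^ n) := by
  induction n with
  | zero => exact isPositiveOp_one
  | succ n ih => rw [pow_succ]; exact ih.mul hP

/-- Positive trace preserving operators. -/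
def IsMarkovOp (P : τ.L1 →L[ℝ] τ.L1) : Prop :=
  IsPositiveOp P ∧ ∀ x, τ.trL1 (P x) = τ.trL1 x

theorem IsUnitalPositiveContraction.isMarkovOp {P : τ.L1 →L[ℝ] τ.L1}
    (hP : IsUnitalPositiveContraction P) : IsMarkovOp P :=
  ⟨hP.1.1, fun x => congrArg (fun f => f x) hP.2⟩

theorem isMarkovOp_one : IsMarkovOp (1 : τ.L1 →L[ℝ] τ.L1) := ⟨isPositiveOp_one, fun _ => rfl⟩

theorem IsMarkovOp.mul {P Q : τ.L1 →L[ℝ] τ.L1} (hP : IsMarkovOp P) (hQ : IsMarkovOp Q) :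
    IsMarkovOp (P * Q) := ⟨hP.1.mul hQ.1, fun x => (hP.2 _).trans (hQ.2 x)⟩

theorem IsMarkovOp.pow {P : τ.L1 →L[ℝ] τ.L1} (hP : IsMarkovOp P) (n : ℕ) :
    IsMarkovOp (P ^ n) := by
  induction n with
  | zero => exact isMarkovOp_one
  | succ n ih => rw [pow_succ]; exact ih.mul hP

theorem IsMarkovOp.norm_le_one {P : τ.L1 →L[ℝ] τ.L1} (hP : IsMarkovOp P) : ‖P‖ ≤ 1 :=
  hP.1.opNorm_le zero_le_one fun x _ => by rw [hP.2, one_mul]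

theorem IsMarkovOp.average {P : τ.L1 →L[ℝ] τ.L1} (hP : IsMarkovOp P) :
    IsMarkovOp ((1 / 2 : ℝ) • (1 + P)) := by
  refine ⟨(isPositiveOp_one.add hP.1).smul (by norm_num), fun x => ?_⟩
  change τ.trL1 ((1 / 2 : ℝ) • (x + P x)) = τ.trL1 x
  rw [_root_.map_smul, _root_.map_add, hP.2, smul_eq_mul]
  ring

/-! ### Splitting an average off the powers of a Markov operator -/

/-- If `W = B S + R` with `W, B` commuting Markov operators and `S, R` positive, then
`W ^ n - R ^ n = B D` for a positive contraction `D`. -/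
theorem exists_pow_eq_mul_add_pow {W B S R : τ.L1 →L[ℝ] τ.L1} (hW : IsMarkovOp W)
    (hB : IsMarkovOp B) (hS : IsPositiveOp S) (hR : IsPositiveOp R) (hWB : Commute W B)
    (h : W = B * S + R) (n : ℕ) :
    ∃ D : τ.L1 →L[ℝ] τ.L1, W ^ n = B * D + R ^ n ∧ ‖D‖ ≤ 1 := by
  have key : ∃ D : τ.L1 →L[ℝ] τ.L1, W ^ n = B * D + R ^ n ∧ IsPositiveOp D := by
    induction n with
    | zero => exact ⟨0, by simp, isPositiveOp_zero⟩
    | succ n ih =>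
      obtain ⟨D, hD, hDpos⟩ := ih
      -- `W * (B * D + R ^ n) = B * (W * D) + (B * S + R) * R ^ n`: only the second `W` is split,
      -- the first commutes past `B`.
      refine ⟨W * D + S * R ^ n, ?_, (hW.1.mul hDpos).add (hS.mul (hR.pow n))⟩
      rw [pow_succ', hD, mul_add, ← mul_assoc, hWB.eq, pow_succ' R]
      nth_rw 2 [h]
      noncomm_ring
  obtain ⟨D, hD, hDpos⟩ := key
  -- As `W ^ n` and `B` preserve the trace, on the cone the trace of `D x` is that of `x` minus that
  -- of `(R ^ n) x ≥ 0`.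
  refine ⟨D, hD, hDpos.opNorm_le zero_le_one fun x hx => ?_⟩
  have h1 : τ.trL1 ((W ^ n) x) = τ.trL1 (D x) + τ.trL1 ((R ^ n) x) := by
    rw [hD, _root_.add_apply, _root_.map_add, mul_apply_eq_comp, hB.2]
  rw [(hW.pow n).2] at h1
  have h2 : 0 ≤ τ.trL1 ((R ^ n) x) := by
    rw [← norm_eq_trL1 (hR.pow n x hx)]
    exact norm_nonneg _
  linarith

/-- Let `U, P` be commuting Markov operators and `S` a positive operator below `U` and `U P` with
`‖U P - S‖ < 1`. Then `‖(1 - P) (U P) ^ N‖` is small for some `N`. -/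
theorem exists_norm_one_sub_mul_pow_lt {U P S : τ.L1 →L[ℝ] τ.L1} (hU : IsMarkovOp U)
    (hP : IsMarkovOp P) (hUP : Commute U P) (hS : IsPositiveOp S) (hle₁ : OpLE S (U * P))
    (hle₂ : OpLE S U) (hlt : ‖U * P - S‖ < 1) {ε : ℝ} (hε : 0 < ε) :
    ∃ N : ℕ, ‖(1 - P) * (U * P) ^ N‖ < ε := by
  set W := U * P with hWdef
  set B : τ.L1 →L[ℝ] τ.L1 := (1 / 2 : ℝ) • (1 + P) with hBdef
  -- This is `W - B * S`, written as the average of the positive operators `W - S` and `P * (U - S)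
  -- = W - P * S`.
  set R : τ.L1 →L[ℝ] τ.L1 := (1 / 2 : ℝ) • (W - S) + (1 / 2 : ℝ) • (P * (U - S)) with hRdef
  have hW : IsMarkovOp W := hU.mul hP
  have hB : IsMarkovOp B := hP.average
  have hWP : Commute W P := hUP.mul_left (Commute.refl P)
  have hWB : Commute W B := ((Commute.one_right W).add_right hWP).smul_right _
  have hR : IsPositiveOp R :=
    (IsPositiveOp.smul hle₁ (by norm_num)).add ((hP.1.mul hle₂).smul (by norm_num))
  have hWBS : W = B * S + R := by
    have e : P * (U - S) = W - P * S := by rw [mul_sub, hWdef, hUP.eq]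
    rw [hRdef, hBdef, e, smul_mul_assoc, add_mul, one_mul]
    module
  -- Since `B` preserves the trace, `R = W - B * S` and `W - S` have the same trace at every vector.
  have hRnorm : ‖R‖ ≤ ‖W - S‖ := by
    refine hR.opNorm_le (norm_nonneg _) fun x hx => ?_
    have h1 : τ.trL1 ((W - S) x) ≤ ‖W - S‖ * τ.trL1 x := by
      rw [← norm_eq_trL1 (hle₁ x hx), ← norm_eq_trL1 hx]
      exact (W - S).le_opNorm x
    have h2 : τ.trL1 (R x) = τ.trL1 ((W - S) x) := by
      have h3 : τ.trL1 (W x) = τ.trL1 (B (S x)) + τ.trL1 (R x) := by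
        conv_lhs => rw [hWBS]
        rw [_root_.add_apply, _root_.map_add, mul_apply_eq_comp]
      rw [hB.2] at h3
      rw [_root_.sub_apply, _root_.map_sub, h3]
      ring
    rw [h2]
    exact h1
  have h1P : ‖(1 : τ.L1 →L[ℝ] τ.L1) - P‖ ≤ 2 := by
    have := norm_sub_le (1 : τ.L1 →L[ℝ] τ.L1) P
    linarith [isMarkovOp_one.norm_le_one (τ := τ), hP.norm_le_one]
  -- The order of choice matters: the error `2 * (j * ‖R ^ n‖)` grows with `j`, so `j` is fixed
  -- before `n`.
  obtain ⟨j, hj⟩ : ∃ j : ℕ, 2 / √((j : ℝ) + 1) < ε / 2 := by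
    have ht : Filter.Tendsto (fun j : ℕ => 2 / √((j : ℝ) + 1)) Filter.atTop (nhds 0) :=
      (Real.tendsto_sqrt_atTop.comp
        (Filter.tendsto_atTop_add_const_right _ _ tendsto_natCast_atTop_atTop)).const_div_atTop 2
    exact (ht.eventually_lt_const (half_pos hε)).exists
  obtain ⟨n, hn⟩ : ∃ n : ℕ, 2 * (j * ‖R ^ n‖) < ε / 2 := by
    have h0 : Filter.Tendsto (fun n : ℕ => R ^ n) Filter.atTop (nhds 0) :=
      tendsto_pow_atTop_nhds_zero_of_norm_lt_one (hRnorm.trans_lt hlt)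
    have ht : Filter.Tendsto (fun n : ℕ => 2 * (j * ‖R ^ n‖)) Filter.atTop (nhds 0) := by
      simpa using (h0.norm.const_mul (j : ℝ)).const_mul 2
    exact (ht.eventually_lt_const (half_pos hε)).exists
  obtain ⟨D, hD, hDnorm⟩ := exists_pow_eq_mul_add_pow hW hB hS hR hWB hWBS n
  obtain ⟨e, r, hr, he, hrn⟩ := exists_pow_eq_pow_mul_add isMarkovOp_one.norm_le_one
    (hW.pow n).norm_le_one (fun i => (hB.pow i).norm_le_one) hDnorm (hWB.pow_left n) hD j
  refine ⟨n * j, ?_⟩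
  rw [pow_mul, hr, mul_add, ← mul_assoc]
  have k1 : ‖(1 - P) * B ^ j * e‖ < ε / 2 := by
    have := norm_one_sub_mul_average_pow_le (fun i => (hP.pow i).norm_le_one) j
    refine (norm_mul_le _ _).trans_lt (lt_of_le_of_lt ?_ hj)
    exact (mul_le_of_le_one_right (norm_nonneg _) he).trans this
  have k2 : ‖(1 - P) * r‖ < ε / 2 :=
    (norm_mul_le _ _).trans_lt (lt_of_le_of_lt (by gcongr) hn)
  linarith [norm_add_le ((1 - P) * B ^ j * e) ((1 - P) * r)]

/-! ### Multi-parameter powers -/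

theorem multiPow_succ {d : ℕ} (T : Fin (d + 1) → (τ.L1 →L[ℝ] τ.L1)) (n : Fin (d + 1) → ℕ) :
    multiPow T n = T 0 ^ n 0 * multiPow (fun i => T i.succ) (fun i => n i.succ) := by
  simp [multiPow, List.ofFn_succ]

theorem isMarkovOp_multiPow {d : ℕ} {T : Fin d → (τ.L1 →L[ℝ] τ.L1)} (hT : ∀ i, IsMarkovOp (T i))
    (n : Fin d → ℕ) : IsMarkovOp (multiPow T n) := by
  induction d with
  | zero => simpa [multiPow] using isMarkovOp_one
  | succ d ih =>
    rw [multiPow_succ]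
    exact ((hT 0).pow _).mul (ih (fun i => hT i.succ) _)

theorem commute_multiPow {d : ℕ} {T : Fin d → (τ.L1 →L[ℝ] τ.L1)} {P : τ.L1 →L[ℝ] τ.L1}
    (h : ∀ i, Commute P (T i)) (n : Fin d → ℕ) : Commute P (multiPow T n) := by
  induction d with
  | zero => simp [multiPow]
  | succ d ih =>
    rw [multiPow_succ]
    exact ((h 0).pow_right _).mul_right (ih (fun i => h i.succ) _)

theorem multiPow_add {d : ℕ} {T : Fin d → (τ.L1 →L[ℝ] τ.L1)} (h : ∀ i j, Commute (T i) (T j))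
    (m n : Fin d → ℕ) : multiPow T (m + n) = multiPow T m * multiPow T n := by
  induction d with
  | zero => simp [multiPow]
  | succ d ih =>
    have hc : Commute (T 0 ^ n 0) (multiPow (fun i => T i.succ) (fun i => m i.succ)) :=
      (commute_multiPow (fun i => h 0 i.succ) _).pow_left _
    have hs := ih (T := fun i => T i.succ) (fun i j => h i.succ j.succ) (fun i => m i.succ)
      (fun i => n i.succ)
    rw [multiPow_succ, multiPow_succ T m, multiPow_succ T n, Pi.add_apply, pow_add, mul_assoc,
      mul_assoc, ← mul_assoc (multiPow _ _) (T 0 ^ n 0), ← hc.eq, mul_assoc, ← hs]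
    rfl

theorem multiPow_nsmul {d : ℕ} {T : Fin d → (τ.L1 →L[ℝ] τ.L1)} (h : ∀ i j, Commute (T i) (T j))
    (N : ℕ) (m : Fin d → ℕ) : multiPow T (N • m) = multiPow T m ^ N := by
  induction N with
  | zero =>
    rw [zero_smul, pow_zero]
    exact List.prod_eq_one fun x hx => by
      obtain ⟨i, rfl⟩ := (List.mem_ofFn' _ _).1 hx
      simp
  | succ N ih => rw [succ_nsmul, multiPow_add h, ih, pow_succ]

end FNSTrace

end NCL1

end

/-! ### From one multi-index to all larger ones -/

theorem corollary4p2 {H : Type*} [NormedAddCommGroup H] [InnerProductSpace ℂ H] [CompleteSpace H]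
    (M : VonNeumannAlgebra H) (τ : NCL1.FNSTrace M) (d : ℕ)
    (T : Fin d → (τ.L1 →L[ℝ] τ.L1))
    (hT : ∀ i, NCL1.FNSTrace.IsUnitalPositiveContraction (T i))
    (hcomm : ∀ i j, T i * T j = T j * T i)
    (m k : Fin d → ℕ) (S : τ.L1 →L[ℝ] τ.L1)
    (hS : NCL1.FNSTrace.IsPositiveContraction S)
    (hle₁ : NCL1.FNSTrace.OpLE S (NCL1.FNSTrace.multiPow T (m + k)))
    (hle₂ : NCL1.FNSTrace.OpLE S (NCL1.FNSTrace.multiPow T m))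
    (hlt₁ : ‖NCL1.FNSTrace.multiPow T (m + k) - S‖ < 1)
    (hlt₂ : ‖NCL1.FNSTrace.multiPow T m - S‖ < 1) :
    Filter.Tendsto
      (fun n : Fin d → ℕ =>
        ‖NCL1.FNSTrace.multiPow T (n + k) - NCL1.FNSTrace.multiPow T n‖)
      Filter.atTop (nhds 0) := by

  open NCL1.FNSTrace in
  have hc : ∀ i j, Commute (T i) (T j) := hcomm
  have hM : ∀ i, IsMarkovOp (T i) := fun i => (hT i).isMarkovOp
  rw [multiPow_add hc] at hle₁ hlt₁
  have hmk : Commute (multiPow T m) (multiPow T k) := by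
    rw [Commute, SemiconjBy, ← multiPow_add hc, ← multiPow_add hc, add_comm]
  rw [Metric.tendsto_atTop]
  intro ε hε
  obtain ⟨N, hN⟩ := exists_norm_one_sub_mul_pow_lt (isMarkovOp_multiPow hM m)
    (isMarkovOp_multiPow hM k) hmk hS.1 hle₁ hle₂ hlt₁ hε
  refine ⟨N • (m + k), fun n hn => ?_⟩
  rw [dist_zero_right, norm_norm]
  obtain ⟨p, rfl⟩ := exists_add_of_le hn
  -- The small operator found for `N` is a factor of the difference at every `N • (m + k) + p`; the
  -- other factor `multiPow T p` is a contraction.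
  have e : multiPow T (N • (m + k) + p + k) - multiPow T (N • (m + k) + p)
      = -((1 - multiPow T k) * (multiPow T m * multiPow T k) ^ N * multiPow T p) := by
    rw [add_comm _ k, multiPow_add hc, multiPow_add hc, multiPow_nsmul hc, multiPow_add hc]
    noncomm_ring
  rw [e, norm_neg]
  refine (norm_mul_le _ _).trans_lt (lt_of_le_of_lt ?_ hN)
  exact mul_le_of_le_one_right (norm_nonneg _) (isMarkovOp_multiPow hM p).norm_le_one
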